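/- A map $f\colon X\to\mathbb{C}^N$ is called $k$-regular if for any $k$ pairwise distinct points $P_1,\dots,P_k\in X$ the vectors $f(P_1),\dots,f(P_k)\in\mathbb{C}^N$ are linearly independent over $\mathbb{C}$. Theorem. The map $$\mathbb{C}^3\ni(s,t,u)\mapsto(1,s,t,u,st,su,tu,s^2,s^3-t^2,t^3-u^2,u^3)\in\mathbb{C}^{11}$$ is $4$-regular. The map $$\mathbb{C}^3\ni(s,t,u)\mapsto(1,s,t,u,st,su,tu,s^2,t^2,u^2,u^3,t^4-s^3,u^4-t^3,s^4)\in\mathbb{C}^{14}$$ is $5$-regular. -/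

import Mathlib

/-- A map `f : X → 𝕜 ^ N` is `k`-regular if the images of any `k` (pairwise distinct) points
of `X` are linearly independent over `𝕜`. -/
def IsKRegular (𝕜 : Type*) [Field 𝕜] {X : Type*} {N : ℕ} (k : ℕ) (f : X → (Fin N → 𝕜)) : Prop :=
  ∀ p : Fin k → X, Function.Injective p → LinearIndependent 𝕜 (fun i => f (p i))

/-- The polynomial map `ℂ³ → ℂ¹¹` with coordinates
`(1, s, t, u, st, su, tu, s², s³ - t², t³ - u², u³)`, where `(s, t, u) = (x 0, x 1, x 2)`. -/
def mapC11 (x : Fin 3 → ℂ) : Fin 11 → ℂ :=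
  let s := x 0
  let t := x 1
  let u := x 2
  ![1, s, t, u, s * t, s * u, t * u, s ^ 2, s ^ 3 - t ^ 2, t ^ 3 - u ^ 2, u ^ 3]

/-- The polynomial map `ℂ³ → ℂ¹⁴` with coordinates
`(1, s, t, u, st, su, tu, s², t², u², u³, t⁴ - s³, u⁴ - t³, s⁴)`,
where `(s, t, u) = (x 0, x 1, x 2)`. -/
def mapC14 (x : Fin 3 → ℂ) : Fin 14 → ℂ :=
  let s := x 0
  let t := x 1
  let u := x 2
  ![1, s, t, u, s * t, s * u, t * u, s ^ 2, t ^ 2, u ^ 2, u ^ 3, t ^ 4 - s ^ 3, u ^ 4 - t ^ 3,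
    s ^ 4]

/-! A relation among the images, restricted to its support, is a weight `c` without zeros on at most
`k` points that annihilates every coordinate of the map. The form `(f, g) ↦ ∑ c f g` is then
nondegenerate, so orthogonal subspaces have total dimension at most `k`. If `y` were not affine in a
nonconstant `x`, this would fail: for `k = 4`, `⟨1, x⟩ ⊥ ⟨1, x, y⟩` gives 2 + 3 > 4; for `k = 5`,
`⟨1, x, y⟩` is isotropic and 3 + 3 > 5. The difference coordinates pass vanishing moments from one
variable to the next. Hence all points lie on a line, parametrised by a coordinate whose moments of
degree below `k` vanish, and Vandermonde forces `c = 0`. -/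

/-- Two linearly independent families which are orthogonal for the nondegenerate diagonal form
`(f, g) ↦ ∑ i, c i * f i * g i` on `K ^ ι` have together at most `#ι` members. -/
lemma card_add_card_le_of_diagonal_orthogonal {K ι : Type*} [Field K] [Fintype ι] {m n : ℕ}
    {c : ι → K} (hc : ∀ i, c i ≠ 0) {v : Fin m → ι → K} {w : Fin n → ι → K}
    (hv : LinearIndependent K v) (hw : LinearIndependent K w)
    (h : ∀ a b, ∑ i, c i * (v a i * w b i) = 0) : m + n ≤ Fintype.card ι := by
  classical
  let A : Matrix (Fin m) ι K := Matrix.of v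
  let B : Matrix (Fin n) ι K := Matrix.of w
  have hD : IsUnit (Matrix.diagonal c).det := by
    rw [Matrix.det_diagonal, isUnit_iff_ne_zero]
    exact Finset.prod_ne_zero_iff.mpr fun i _ => hc i
  have hA : A.rank = m := by simpa using LinearIndependent.rank_matrix (M := A) hv
  have hB : B.rank = n := by simpa using LinearIndependent.rank_matrix (M := B) hw
  have hAD : (A * Matrix.diagonal c).rank = m := by
    rw [Matrix.rank_mul_eq_left_of_isUnit_det _ _ hD, hA]
  have h0 : A * Matrix.diagonal c * B.transpose = 0 := by
    ext a b
    rw [Matrix.mul_apply, Matrix.zero_apply, ← h a b]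
    refine Finset.sum_congr rfl fun i _ => ?_
    simp only [Matrix.mul_diagonal, Matrix.transpose_apply, A, B, Matrix.of_apply]
    ring
  have := Matrix.rank_add_rank_le_card_of_mul_eq_zero h0
  rwa [hAD, Matrix.rank_transpose, hB] at this

/-- A measure on points of a line, at most as many as there are vanishing moments, is zero. -/
lemma eq_zero_of_forall_sum_mul_pow_eq_zero {K ι : Type*} [Field K] [Fintype ι] {c x : ι → K}
    (hx : Function.Injective x) (h : ∀ k < Fintype.card ι, ∑ i, c i * x i ^ k = 0) : c = 0 := by
  let e := Fintype.equivFin ι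
  have key : c ∘ e.symm = 0 := by
    refine Matrix.eq_zero_of_forall_pow_sum_mul_pow_eq_zero (f := x ∘ e.symm)
      (hx.comp e.symm.injective) fun k => ?_
    rw [← h k k.2]
    exact e.symm.sum_comp (fun i => c i * x i ^ (k : ℕ))
  funext i
  simpa using congrFun key (e i)

lemma linearIndependent_one_of_ne {K ι : Type*} [Field K] {x : ι → K} {i j : ι}
    (hx : x i ≠ x j) : LinearIndependent K ![1, x] := by
  rw [LinearIndependent.pair_iff]
  intro α β h
  have hi := congrFun h i
  have hj := congrFun h j
  simp only [Pi.add_apply, Pi.smul_apply, Pi.one_apply, Pi.zero_apply, smul_eq_mul] at hi hj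
  have hβ : β = 0 := by
    have : β * (x i - x j) = 0 := by linear_combination hi - hj
    exact (mul_eq_zero.mp this).resolve_right (sub_ne_zero.mpr hx)
  subst hβ
  exact ⟨by linear_combination hi, rfl⟩

lemma linearIndependent_one_pair {K ι : Type*} [Field K] {x y : ι → K} {i j : ι}
    (hx : x i ≠ x j) (hy : ¬ ∃ α β : K, ∀ l, y l = α + β * x l) :
    LinearIndependent K ![y, 1, x] := by
  refine LinearIndependent.finCons (linearIndependent_one_of_ne hx) fun hmem => hy ?_
  rw [Matrix.range_cons, Matrix.range_cons, Matrix.range_empty, Set.union_empty,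
    Set.singleton_union, Submodule.mem_span_pair] at hmem
  obtain ⟨α, β, rfl⟩ := hmem
  exact ⟨α, β, fun l => by simp⟩

section Moments

variable {K ι : Type*} [Field K] [Fintype ι] {c x y : ι → K}

/-- If `c` is orthogonal to `1, x, x², y, xy`, and lives on at most four points, then `y` is affine
in `x` unless `x` is constant. -/
lemma exists_affine_of_card_le_four (hc : ∀ i, c i ≠ 0) (hcard : Fintype.card ι ≤ 4) {i j : ι}
    (hx : x i ≠ x j) (h1 : ∑ i, c i = 0) (hx1 : ∑ i, c i * x i = 0)
    (hx2 : ∑ i, c i * x i ^ 2 = 0) (hy1 : ∑ i, c i * y i = 0)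
    (hxy : ∑ i, c i * (x i * y i) = 0) : ∃ α β : K, ∀ l, y l = α + β * x l := by
  by_contra hy
  have := card_add_card_le_of_diagonal_orthogonal hc (linearIndependent_one_of_ne hx)
    (linearIndependent_one_pair hx hy) fun a b => by
      fin_cases a <;> fin_cases b <;> simp [h1, hx1, hy1, hxy, ← pow_two, hx2]
  omega

/-- If `c` is orthogonal to `1, x, x², y, xy, y²`, and lives on at most five points, then `y` is
affine in `x` unless `x` is constant. -/
lemma exists_affine_of_card_le_five (hc : ∀ i, c i ≠ 0) (hcard : Fintype.card ι ≤ 5) {i j : ι}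
    (hx : x i ≠ x j) (h1 : ∑ i, c i = 0) (hx1 : ∑ i, c i * x i = 0)
    (hx2 : ∑ i, c i * x i ^ 2 = 0) (hy1 : ∑ i, c i * y i = 0)
    (hxy : ∑ i, c i * (x i * y i) = 0) (hy2 : ∑ i, c i * y i ^ 2 = 0) :
    ∃ α β : K, ∀ l, y l = α + β * x l := by
  by_contra hy
  have := card_add_card_le_of_diagonal_orthogonal hc (linearIndependent_one_pair hx hy)
    (linearIndependent_one_pair hx hy) fun a b => by
      fin_cases a <;> fin_cases b <;>
        simp [h1, hx1, hy1, hxy, mul_comm (y _) (x _), ← pow_two, hx2, hy2]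
  omega

/-- Expanding only one factor, `y² = αy + βxy`, so no moment of `x²` is needed. -/
lemma sum_mul_sq_eq_zero_of_affine {α β : K} (h : ∀ l, y l = α + β * x l)
    (hy1 : ∑ i, c i * y i = 0) (hxy : ∑ i, c i * (x i * y i) = 0) :
    ∑ i, c i * y i ^ 2 = 0 := by
  calc ∑ i, c i * y i ^ 2 = ∑ i, (α * (c i * y i) + β * (c i * (x i * y i))) :=
        Finset.sum_congr rfl fun i _ => by rw [pow_two]; nth_rewrite 1 [h i]; ring
    _ = 0 := by rw [Finset.sum_add_distrib, ← Finset.mul_sum, ← Finset.mul_sum, hy1, hxy]; ring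

lemma sum_mul_cube_eq_zero_of_affine {α β : K} (h : ∀ l, y l = α + β * x l)
    (h1 : ∑ i, c i = 0) (hx1 : ∑ i, c i * x i = 0) (hx2 : ∑ i, c i * x i ^ 2 = 0)
    (hx3 : ∑ i, c i * x i ^ 3 = 0) : ∑ i, c i * y i ^ 3 = 0 := by
  calc ∑ i, c i * y i ^ 3 = ∑ i, (α ^ 3 * c i + 3 * α ^ 2 * β * (c i * x i) +
          3 * α * β ^ 2 * (c i * x i ^ 2) + β ^ 3 * (c i * x i ^ 3)) :=
        Finset.sum_congr rfl fun i _ => by rw [h i]; ring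
    _ = 0 := by
      simp only [Finset.sum_add_distrib, ← Finset.mul_sum, h1, hx1, hx2, hx3]; ring

lemma sum_mul_pow_eq_zero_of_const (h : ∀ i j, x i = x j) (h1 : ∑ i, c i = 0) (k : ℕ) :
    ∑ i, c i * x i ^ k = 0 := by
  rcases isEmpty_or_nonempty ι with _ | ⟨⟨o⟩⟩
  · simp
  · calc ∑ i, c i * x i ^ k = ∑ i, c i * x o ^ k :=
          Finset.sum_congr rfl fun i _ => by rw [h i o]
      _ = 0 := by rw [← Finset.sum_mul, h1, zero_mul]

end Moments

/-- To prove `k`-regularity it is enough to exclude linear relations with nonzero coefficients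
between the images of at most `k` points, with at least one point. -/
lemma isKRegular_of_forall_relation {𝕜 X : Type} [Field 𝕜] {N k : ℕ} {f : X → Fin N → 𝕜}
    (H : ∀ (ι : Type) [Fintype ι] (p : ι → X) (c : ι → 𝕜), Fintype.card ι ≤ k →
      Function.Injective p → (∀ i, c i ≠ 0) → (∀ n, ∑ i, c i * f (p i) n = 0) → c = 0) :
    IsKRegular 𝕜 k f := by
  classical
  intro p hp
  rw [Fintype.linearIndependent_iff]
  intro g hg
  by_contra! hne
  obtain ⟨o, ho⟩ := hne
  -- Dropping the points of zero weight preserves the relation and makes the diagonal form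
  -- nondegenerate.
  have h0 := H {i // g i ≠ 0} (fun i => p i) (fun i => g i)
    ((Fintype.card_subtype_le _).trans_eq (Fintype.card_fin k))
    (hp.comp Subtype.val_injective) (fun i => i.2) fun n => by
      have hn := congrFun hg n
      simp only [Finset.sum_apply, Pi.smul_apply, smul_eq_mul, Pi.zero_apply] at hn
      refine Eq.trans ?_ hn
      rw [← Finset.sum_subtype {i | g i ≠ 0} (by simp) fun i => g i * f (p i) n]
      exact Finset.sum_filter_of_ne fun i _ h => left_ne_zero_of_mul h
  exact ho (congrFun h0 ⟨o, ho⟩)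

lemma injective_of_affine_coordinates {K ι : Type*} [Field K] {p : ι → Fin 3 → K}
    (hp : Function.Injective p) {z : ι → K}
    (h : ∀ a, ∃ α β : K, ∀ i, p i a = α + β * z i) : Function.Injective z := by
  intro i j hij
  refine hp (funext fun a => ?_)
  obtain ⟨α, β, hab⟩ := h a
  rw [hab i, hab j, hij]

lemma exists_affine_of_const {K ι : Type*} [Field K] {y : ι → K} (h : ∀ i j, y i = y j)
    (x : ι → K) : ∃ α β : K, ∀ i, y i = α + β * x i := by
  rcases isEmpty_or_nonempty ι with _ | ⟨⟨o⟩⟩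
  · exact ⟨0, 0, fun i => isEmptyElim i⟩
  · exact ⟨y o, 0, fun i => by rw [h i o]; ring⟩

lemma isKRegular_mapC11 : IsKRegular ℂ 4 mapC11 := by
  refine isKRegular_of_forall_relation fun ι _ p c hcard hp hc hf => ?_
  obtain ⟨s, hs⟩ : ∃ s : ι → ℂ, ∀ i, p i 0 = s i := ⟨_, fun _ => rfl⟩
  obtain ⟨t, ht⟩ : ∃ t : ι → ℂ, ∀ i, p i 1 = t i := ⟨_, fun _ => rfl⟩
  obtain ⟨u, hu⟩ : ∃ u : ι → ℂ, ∀ i, p i 2 = u i := ⟨_, fun _ => rfl⟩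
  simp only [mapC11, hs, ht, hu] at hf
  have m1 : ∑ i, c i = 0 := by simpa using hf 0
  have ms : ∑ i, c i * s i = 0 := hf 1
  have mt : ∑ i, c i * t i = 0 := hf 2
  have mu : ∑ i, c i * u i = 0 := hf 3
  have mst : ∑ i, c i * (s i * t i) = 0 := hf 4
  have msu : ∑ i, c i * (s i * u i) = 0 := hf 5
  have mtu : ∑ i, c i * (t i * u i) = 0 := hf 6
  have ms2 : ∑ i, c i * s i ^ 2 = 0 := hf 7
  have m8 : ∑ i, c i * s i ^ 3 = ∑ i, c i * t i ^ 2 := by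
    rw [← sub_eq_zero, ← Finset.sum_sub_distrib, ← hf 8]
    exact Finset.sum_congr rfl fun i _ => (mul_sub _ _ _).symm
  have m9 : ∑ i, c i * t i ^ 3 = ∑ i, c i * u i ^ 2 := by
    rw [← sub_eq_zero, ← Finset.sum_sub_distrib, ← hf 9]
    exact Finset.sum_congr rfl fun i _ => (mul_sub _ _ _).symm
  have mu3 : ∑ i, c i * u i ^ 3 = 0 := hf 10
  have mu_s : ∑ i, c i * (u i * s i) = 0 := by simpa only [mul_comm (u _)] using msu
  have mu_t : ∑ i, c i * (u i * t i) = 0 := by simpa only [mul_comm (u _)] using mtu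
  have mt_s : ∑ i, c i * (t i * s i) = 0 := by simpa only [mul_comm (t _)] using mst
  -- For constant `s` the moment of `s³`, hence that of `t²`, vanishes; otherwise `t` is affine in
  -- `s`. The same dichotomy then passes from `t` to `u`.
  have mt2 : ∑ i, c i * t i ^ 2 = 0 := by
    by_cases h : ∀ i j, s i = s j
    · rw [← m8, sum_mul_pow_eq_zero_of_const h m1]
    · push Not at h
      obtain ⟨i, j, hij⟩ := h
      obtain ⟨α, β, h⟩ := exists_affine_of_card_le_four hc hcard hij m1 ms ms2 mt mst
      exact sum_mul_sq_eq_zero_of_affine h mt mst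
  have mu2 : ∑ i, c i * u i ^ 2 = 0 := by
    by_cases h : ∀ i j, t i = t j
    · rw [← m9, sum_mul_pow_eq_zero_of_const h m1]
    · push Not at h
      obtain ⟨i, j, hij⟩ := h
      obtain ⟨α, β, h⟩ := exists_affine_of_card_le_four hc hcard hij m1 mt mt2 mu mtu
      exact sum_mul_sq_eq_zero_of_affine h mu mtu
  have finish : ∀ z : ι → ℂ, (∑ i, c i * z i = 0) → (∑ i, c i * z i ^ 2 = 0) →
      (∑ i, c i * z i ^ 3 = 0) → (∃ α β : ℂ, ∀ i, s i = α + β * z i) →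
      (∃ α β : ℂ, ∀ i, t i = α + β * z i) → (∃ α β : ℂ, ∀ i, u i = α + β * z i) → c = 0 := by
    intro z z1 z2 z3 h0 h1 h2
    refine eq_zero_of_forall_sum_mul_pow_eq_zero (x := z) (injective_of_affine_coordinates hp
      fun a => by fin_cases a <;> simpa [hs, ht, hu]) fun k hk => ?_
    have hk : k < 4 := by omega
    interval_cases k <;> simpa
  have self : ∀ z : ι → ℂ, ∃ α β : ℂ, ∀ i, z i = α + β * z i := fun z => ⟨0, 1, by simp⟩
  -- The parameter of the line is the last nonconstant coordinate among `s, t, u`, or `s` if all are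
  -- constant.
  by_cases hu' : ∀ i j, u i = u j
  · by_cases ht' : ∀ i j, t i = t j
    · exact finish s ms ms2 (m8.trans mt2) (self s) (exists_affine_of_const ht' s)
        (exists_affine_of_const hu' s)
    · push Not at ht'
      obtain ⟨i, j, hij⟩ := ht'
      exact finish t mt mt2 (m9.trans mu2)
        (exists_affine_of_card_le_four hc hcard hij m1 mt mt2 ms mt_s) (self t)
        (exists_affine_of_const hu' t)
  · push Not at hu'
    obtain ⟨i, j, hij⟩ := hu'
    exact finish u mu mu2 mu3 (exists_affine_of_card_le_four hc hcard hij m1 mu mu2 ms mu_s)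
      (exists_affine_of_card_le_four hc hcard hij m1 mu mu2 mt mu_t) (self u)

lemma isKRegular_mapC14 : IsKRegular ℂ 5 mapC14 := by
  refine isKRegular_of_forall_relation fun ι _ p c hcard hp hc hf => ?_
  obtain ⟨s, hs⟩ : ∃ s : ι → ℂ, ∀ i, p i 0 = s i := ⟨_, fun _ => rfl⟩
  obtain ⟨t, ht⟩ : ∃ t : ι → ℂ, ∀ i, p i 1 = t i := ⟨_, fun _ => rfl⟩
  obtain ⟨u, hu⟩ : ∃ u : ι → ℂ, ∀ i, p i 2 = u i := ⟨_, fun _ => rfl⟩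
  simp only [mapC14, hs, ht, hu] at hf
  have m1 : ∑ i, c i = 0 := by simpa using hf 0
  have ms : ∑ i, c i * s i = 0 := hf 1
  have mt : ∑ i, c i * t i = 0 := hf 2
  have mu : ∑ i, c i * u i = 0 := hf 3
  have mst : ∑ i, c i * (s i * t i) = 0 := hf 4
  have msu : ∑ i, c i * (s i * u i) = 0 := hf 5
  have mtu : ∑ i, c i * (t i * u i) = 0 := hf 6
  have ms2 : ∑ i, c i * s i ^ 2 = 0 := hf 7
  have mt2 : ∑ i, c i * t i ^ 2 = 0 := hf 8
  have mu2 : ∑ i, c i * u i ^ 2 = 0 := hf 9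
  have mu3 : ∑ i, c i * u i ^ 3 = 0 := hf 10
  have m11 : ∑ i, c i * t i ^ 4 = ∑ i, c i * s i ^ 3 := by
    rw [← sub_eq_zero, ← Finset.sum_sub_distrib, ← hf 11]
    exact Finset.sum_congr rfl fun i _ => (mul_sub _ _ _).symm
  have m12 : ∑ i, c i * u i ^ 4 = ∑ i, c i * t i ^ 3 := by
    rw [← sub_eq_zero, ← Finset.sum_sub_distrib, ← hf 12]
    exact Finset.sum_congr rfl fun i _ => (mul_sub _ _ _).symm
  have ms4 : ∑ i, c i * s i ^ 4 = 0 := hf 13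
  have mu_s : ∑ i, c i * (u i * s i) = 0 := by simpa only [mul_comm (u _)] using msu
  have mu_t : ∑ i, c i * (u i * t i) = 0 := by simpa only [mul_comm (u _)] using mtu
  have mt_s : ∑ i, c i * (t i * s i) = 0 := by simpa only [mul_comm (t _)] using mst
  have finish : ∀ z : ι → ℂ, (∑ i, c i * z i = 0) → (∑ i, c i * z i ^ 2 = 0) →
      (∑ i, c i * z i ^ 3 = 0) → (∑ i, c i * z i ^ 4 = 0) →
      (∃ α β : ℂ, ∀ i, s i = α + β * z i) → (∃ α β : ℂ, ∀ i, t i = α + β * z i) →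
      (∃ α β : ℂ, ∀ i, u i = α + β * z i) → c = 0 := by
    intro z z1 z2 z3 z4 h0 h1 h2
    refine eq_zero_of_forall_sum_mul_pow_eq_zero (x := z) (injective_of_affine_coordinates hp
      fun a => by fin_cases a <;> simpa [hs, ht, hu]) fun k hk => ?_
    have hk : k < 5 := by omega
    interval_cases k <;> simpa
  have self : ∀ z : ι → ℂ, ∃ α β : ℂ, ∀ i, z i = α + β * z i := fun z => ⟨0, 1, by simp⟩
  -- All second moments vanish, so only the third and fourth moments of the parameter remain. Here
  -- the chain runs downwards: constant `u` kills the moment of `t³`, and constant `t` that of `s³`.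
  by_cases hu' : ∀ i j, u i = u j
  · have mt3 := m12.symm.trans (sum_mul_pow_eq_zero_of_const hu' m1 4)
    by_cases ht' : ∀ i j, t i = t j
    · exact finish s ms ms2 (m11.symm.trans (sum_mul_pow_eq_zero_of_const ht' m1 4)) ms4
        (self s) (exists_affine_of_const ht' s) (exists_affine_of_const hu' s)
    · push Not at ht'
      obtain ⟨i, j, hij⟩ := ht'
      obtain ⟨α, β, h⟩ := exists_affine_of_card_le_five hc hcard hij m1 mt mt2 ms mt_s ms2
      -- The fourth moment of `t` equals the third moment of `s`, which is cubic in `t` and so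
      -- already vanishes.
      exact finish t mt mt2 mt3 (m11.trans (sum_mul_cube_eq_zero_of_affine h m1 mt mt2 mt3))
        ⟨α, β, h⟩ (self t) (exists_affine_of_const hu' t)
  · push Not at hu'
    obtain ⟨i, j, hij⟩ := hu'
    obtain ⟨α, β, h⟩ := exists_affine_of_card_le_five hc hcard hij m1 mu mu2 mt mu_t mt2
    -- Likewise the fourth moment of `u` is the third moment of `t`, with `t` affine in `u`.
    exact finish u mu mu2 mu3 (m12.trans (sum_mul_cube_eq_zero_of_affine h m1 mu mu2 mu3))
      (exists_affine_of_card_le_five hc hcard hij m1 mu mu2 ms mu_s ms2) ⟨α, β, h⟩ (self u)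

theorem mainTheorem1 : IsKRegular ℂ 4 mapC11 ∧ IsKRegular ℂ 5 mapC14 :=
  ⟨isKRegular_mapC11, isKRegular_mapC14⟩
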